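/- Let $m,n\ge 1$, let $I,J\subseteq\mathbb{R}$ be open sets (for instance $I=J=\mathbb{R}^+=(0,\infty)$, or the bounded intervals $(0,b)$), let $\sigma:I\to(0,\infty)$ and $\lambda:J\to(0,\infty)$ be smooth, and let $g^{S^{d}}$ be the standard metric of the unit sphere $S^d$. Let $\varphi:S^{m-1}\to S^{n-1}$ be an eigenmap with eigenvalue $2k$, that is, a smooth harmonic map with constant energy density $e(\varphi)=\tfrac12|{\rm d}\varphi|^2=k$, and let $\rho:I\to J$ be smooth. Consider the equivariant map $$\phi:(I\times S^{m-1},\,{\rm d}r^2+\sigma^2(r)g^{S^{m-1}})\to(J\times S^{n-1},\,{\rm d}\rho^2+\lambda^2(\rho)g^{S^{n-1}}),\qquad \phi(r,\theta)=(\rho(r),\varphi(\theta)).$$ A smooth map $\phi:(M,g)\to(N,h)$ is called biharmonic if its bitension field vanishes identically, that is, if $$\tau_2(\phi)={\rm Tr}_g\big[(\nabla^\phi\nabla^\phi-\nabla^\phi_{\nabla})\tau(\phi)-R^N({\rm d}\phi,\tau(\phi)){\rm d}\phi\big]=0,$$ where $\tau(\phi)={\rm Tr}_g\nabla{\rm d}\phi$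 is the tension field and $R^N(X,Y)Z=\nabla_X\nabla_YZ-\nabla_Y\nabla_XZ-\nabla_{[X,Y]}Z$. Then the following are equivalent: (1) $\phi$ is biharmonic; (2) $\rho$ is a solution on $I$ of the system $$\begin{cases}F=\rho''+(m-1)\dfrac{\sigma'}{\sigma}\rho'-2k\,\dfrac{(\lambda\lambda')(\rho)}{\sigma^2},\\[2mm] F''+(m-1)\dfrac{\sigma'}{\sigma}F'-2k\,\dfrac{(\lambda\lambda')'(\rho)}{\sigma^2}F=0;\end{cases}$$ (3) $\rho$ satisfies the fourth-order equation $$\Delta^2\rho-2k\,\Delta\!\left(\frac{(\lambda\lambda')(\rho)}{\sigma^2}\right)-2k\,\frac{(\lambda\lambda')'(\rho)}{\sigma^2}\left(\Delta\rho-2k\,\frac{(\lambda\lambda')(\rho)}{\sigma^2}\right)=0,$$ where $\Delta={\rm Tr}_g\nabla{\rm d}$ is the Laplace-Beltrami operator of $(I\times S^{m-1},\,{\rm d}r^2+\sigma^2g^{S^{m-1}})$ and functions of $r\in I$ are regarded as functions on $I\times S^{m-1}$. -/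

import Mathlib

open scoped Manifold ContDiff

noncomputable section

/-! ### Riemannian calculus in local coordinates

`E` and `E'` are the model vector spaces of the domain and of the target, `G` and `G'` are Riemannian
metrics in local coordinates, i.e. functions with values in the bilinear forms on `E` and `E'`. All
formulas are the usual coordinate formulas, written without indices. -/

section Local

variable {E : Type*} [NormedAddCommGroup E] [NormedSpace ℝ E]
variable {E' : Type*} [NormedAddCommGroup E'] [NormedSpace ℝ E']
variable {F : Type*} [AddCommGroup F]

/-- The Christoffel symbols of the Levi-Civita connection, `Γ_p(u, v) = Γᵏᵢⱼ uⁱ vʲ ∂ₖ`: the vector with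
`G_p(Γ_p(u, v), w) = ½ (∂_u G(v, w) + ∂_v G(u, w) - ∂_w G(u, v))` for all `w`. -/
def christoffel (G : E → E →L[ℝ] E →L[ℝ] ℝ) (p u v : E) : E :=
  (G p).inverse ((1 / 2 : ℝ) •
    (fderiv ℝ G p u v + fderiv ℝ G p v u - ((fderiv ℝ G p).flip u).flip v))

/-- The curvature tensor `R(u, v) w = ∇_u ∇_v w - ∇_v ∇_u w - ∇_[u,v] w`, at the point `p`. -/
def curvature (G : E → E →L[ℝ] E →L[ℝ] ℝ) (p u v w : E) : E :=
  fderiv ℝ (fun x => christoffel G x v w) p u - fderiv ℝ (fun x => christoffel G x u w) p v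
    + christoffel G p u (christoffel G p v w) - christoffel G p v (christoffel G p u w)

/-- The trace `Gⁱʲ B(∂ᵢ, ∂ⱼ)` with respect to the metric `G` at the point `p` of a bilinear map `B`. -/
def metricTrace [FiniteDimensional ℝ E] (G : E → E →L[ℝ] E →L[ℝ] ℝ) (p : E) (B : E → E → F) : F :=
  ∑ j, B (Module.finBasis ℝ E j)
    ((G p).inverse (LinearMap.toContinuousLinearMap ((Module.finBasis ℝ E).coord j)))

/-- The covariant derivative `∇^f_u X` along the map `f`, in the direction of the coordinate vector
`u`, of a vector field `X` along `f`; the target carries the metric `G'`. -/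
def covDerivAlong (G' : E' → E' →L[ℝ] E' →L[ℝ] ℝ) (f X : E → E') (u : E) : E → E' := fun p =>
  fderiv ℝ X p u + christoffel G' (f p) (fderiv ℝ f p u) (X p)

/-- The second covariant derivative `∇^f_u ∇^f_v X - ∇^f_{∇_u v} X` of a vector field `X` along `f`. -/
def secondCovDerivAlong (G : E → E →L[ℝ] E →L[ℝ] ℝ) (G' : E' → E' →L[ℝ] E' →L[ℝ] ℝ)
    (f X : E → E') (p u v : E) : E' :=
  covDerivAlong G' f (covDerivAlong G' f X v) u p
    - covDerivAlong G' f X (christoffel G p u v) p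

/-- The energy density `e(f) = ½ |df|²`. -/
def localEnergyDensity [FiniteDimensional ℝ E] (G : E → E →L[ℝ] E →L[ℝ] ℝ)
    (G' : E' → E' →L[ℝ] E' →L[ℝ] ℝ) (f : E → E') (p : E) : ℝ :=
  1 / 2 * metricTrace G p (fun u v => G' (f p) (fderiv ℝ f p u) (fderiv ℝ f p v))

/-- The tension field `τ(f) = Tr_G (∇ df)`, where
`(∇ df)(u, v) = ∇^f_u (df v) - df (∇_u v) = D²f(u, v) + Γ'(df u, df v) - df (Γ(u, v))`. -/
def localTension [FiniteDimensional ℝ E] (G : E → E →L[ℝ] E →L[ℝ] ℝ)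
    (G' : E' → E' →L[ℝ] E' →L[ℝ] ℝ) (f : E → E') (p : E) : E' :=
  metricTrace G p (fun u v =>
    covDerivAlong G' f (fun x => fderiv ℝ f x v) u p - fderiv ℝ f p (christoffel G p u v))

/-- The bitension field
`τ₂(f) = Tr_G (∇^f ∇^f τ(f) - ∇^f_∇ τ(f) - R'(df, τ(f)) df)`. -/
def localBitension [FiniteDimensional ℝ E] (G : E → E →L[ℝ] E →L[ℝ] ℝ)
    (G' : E' → E' →L[ℝ] E' →L[ℝ] ℝ) (f : E → E') (p : E) : E' :=
  metricTrace G p (fun u v =>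
    secondCovDerivAlong G G' f (localTension G G' f) p u v
      - curvature G' (f p) (fderiv ℝ f p u) (localTension G G' f p) (fderiv ℝ f p v))

/-- The Laplacian `Tr_G (∇ du)` of a function `u`. -/
def localLaplacian [FiniteDimensional ℝ E] (G : E → E →L[ℝ] E →L[ℝ] ℝ) (u : E → ℝ) (p : E) : ℝ :=
  metricTrace G p (fun v w =>
    fderiv ℝ (fun x => fderiv ℝ u x w) p v - fderiv ℝ u p (christoffel G p v w))

end Local

/-! ### Harmonic and biharmonic maps between Riemannian manifolds (without boundary) -/

section Manifold

variable {E : Type*} [NormedAddCommGroup E] [NormedSpace ℝ E]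
  {H : Type*} [TopologicalSpace H] (I : ModelWithCorners ℝ E H)
  (M : Type*) [TopologicalSpace M] [ChartedSpace H M]

/-- A field of bilinear forms on the tangent spaces of `M`. -/
abbrev MetricField : Type _ :=
  ∀ x : M, TangentSpace I x →L[ℝ] TangentSpace I x →L[ℝ] ℝ

variable {I M}
variable {E' : Type*} [NormedAddCommGroup E'] [NormedSpace ℝ E']
  {H' : Type*} [TopologicalSpace H'] {I' : ModelWithCorners ℝ E' H'}
  {N : Type*} [TopologicalSpace N] [ChartedSpace H' N]

/-- The metric `g` in the preferred chart `χ` around `a`: its value at `p` on `u, v` is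
`g (dχ⁻¹ u, dχ⁻¹ v)` at the point `χ⁻¹ p`. -/
def chartMetric (g : MetricField I M) (a : M) (p : E) : E →L[ℝ] E →L[ℝ] ℝ :=
  let gp : E →L[ℝ] E →L[ℝ] ℝ := g ((extChartAt I a).symm p)
  let A : E →L[ℝ] E := mfderiv 𝓘(ℝ, E) I (extChartAt I a).symm p
  gp.bilinearComp A A

variable (I I') in
/-- The map `f` in the preferred charts around `a` and `b`. -/
def chartMap (f : M → N) (a : M) (b : N) : E → E' :=
  extChartAt I' b ∘ f ∘ (extChartAt I a).symm

/-- `f` is harmonic: it is smooth and its tension field vanishes at each point, in all the preferred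
charts around that point and around its image. -/
def IsHarmonicMap [FiniteDimensional ℝ E] (g : MetricField I M) (h : MetricField I' N)
    (f : M → N) : Prop :=
  ContMDiff I I' ∞ f ∧ ∀ (a : M) (b : N), ∀ x ∈ (extChartAt I a).source,
    f x ∈ (extChartAt I' b).source →
      localTension (chartMetric g a) (chartMetric h b) (chartMap I I' f a b) (extChartAt I a x) = 0

/-- `f` is biharmonic: it is smooth and its bitension field vanishes at each point, in all the preferred
charts around that point and around its image. -/
def IsBiharmonicMap [FiniteDimensional ℝ E] (g : MetricField I M) (h : MetricField I' N)
    (f : M → N) : Prop :=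
  ContMDiff I I' ∞ f ∧ ∀ (a : M) (b : N), ∀ x ∈ (extChartAt I a).source,
    f x ∈ (extChartAt I' b).source →
      localBitension (chartMetric g a) (chartMetric h b) (chartMap I I' f a b)
        (extChartAt I a x) = 0

/-- `f` has constant energy density `½ |df|² = k`. -/
def HasConstantEnergyDensity [FiniteDimensional ℝ E] (g : MetricField I M) (h : MetricField I' N)
    (f : M → N) (k : ℝ) : Prop :=
  ∀ (a : M) (b : N), ∀ x ∈ (extChartAt I a).source, f x ∈ (extChartAt I' b).source →
    localEnergyDensity (chartMetric g a) (chartMetric h b) (chartMap I I' f a b)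
      (extChartAt I a x) = k

/-- The Laplace-Beltrami operator on functions, with the sign for which it is `∂²` on the line. -/
def laplaceBeltrami [FiniteDimensional ℝ E] (g : MetricField I M) (u : M → ℝ) (x : M) : ℝ :=
  localLaplacian (chartMetric g x) (u ∘ (extChartAt I x).symm) (extChartAt I x x)

end Manifold

/-! ### Round spheres and warped products -/

/-- The unit sphere `S^p` in `ℝ^(p+1)`. -/
abbrev UnitSphere (p : ℕ) : Type := Metric.sphere (0 : EuclideanSpace ℝ (Fin (p + 1))) 1

/-- The standard metric of `S^p`, induced by the inner product of `ℝ^(p+1)`. -/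
def roundMetric (p : ℕ) : MetricField (𝓡 p) (UnitSphere p) := fun θ =>
  let A : EuclideanSpace ℝ (Fin p) →L[ℝ] EuclideanSpace ℝ (Fin (p + 1)) :=
    mfderiv (𝓡 p) 𝓘(ℝ, EuclideanSpace ℝ (Fin (p + 1)))
      (fun x : UnitSphere p => (x : EuclideanSpace ℝ (Fin (p + 1)))) θ
  let B : EuclideanSpace ℝ (Fin p) →L[ℝ] EuclideanSpace ℝ (Fin p) →L[ℝ] ℝ :=
    (innerSL ℝ : EuclideanSpace ℝ (Fin (p + 1)) →L[ℝ] EuclideanSpace ℝ (Fin (p + 1)) →L[ℝ] ℝ).bilinearComp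
      A A
  B

/-- The metric `dr² + σ(r)² g` on `U × S^p`, where `U ⊆ ℝ` is open and `g` is the standard metric. -/
def warpedMetric (p : ℕ) (U : TopologicalSpace.Opens ℝ) (σ : ℝ → ℝ) :
    MetricField (𝓘(ℝ, ℝ).prod (𝓡 p)) (U × UnitSphere p) := fun x =>
  let g : EuclideanSpace ℝ (Fin p) →L[ℝ] EuclideanSpace ℝ (Fin p) →L[ℝ] ℝ := roundMetric p x.2
  let P₁ := ContinuousLinearMap.fst ℝ ℝ (EuclideanSpace ℝ (Fin p))
  let P₂ := ContinuousLinearMap.snd ℝ ℝ (EuclideanSpace ℝ (Fin p))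
  let B : ℝ × EuclideanSpace ℝ (Fin p) →L[ℝ] ℝ × EuclideanSpace ℝ (Fin p) →L[ℝ] ℝ :=
    (ContinuousLinearMap.mul ℝ ℝ).bilinearComp P₁ P₁ + (σ x.1) ^ 2 • g.bilinearComp P₂ P₂
  B

/-- `φ : S^p → S^q` is an eigenmap with eigenvalue `2k`: a harmonic map with constant energy density
`e(φ) = k`. -/
def IsEigenmap (p q : ℕ) (φ : UnitSphere p → UnitSphere q) (k : ℝ) : Prop :=
  IsHarmonicMap (roundMetric p) (roundMetric q) φ ∧
    HasConstantEnergyDensity (roundMetric p) (roundMetric q) φ k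

/-- The equivariant map `(r, θ) ↦ (ρ r, φ θ)`. -/
def equivariantMap {p q : ℕ} {U V : TopologicalSpace.Opens ℝ} (ρ : ℝ → ℝ) (hρ : ∀ r ∈ U, ρ r ∈ V)
    (φ : UnitSphere p → UnitSphere q) (x : U × UnitSphere p) : V × UnitSphere q :=
  (⟨ρ x.1, hρ x.1 x.1.2⟩, φ x.2)

end

noncomputable section

open Filter Topology

/-! ### Traces of bilinear maps -/

section Trace

variable {E : Type*} [NormedAddCommGroup E] [NormedSpace ℝ E] [FiniteDimensional ℝ E]
variable {F : Type*} [AddCommGroup F] [Module ℝ F]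

/-- The contraction of a bilinear map does not depend on the basis. -/
lemma sum_basis_coord_eq {ι κ : Type*} [Fintype ι] [Fintype κ] (b : Module.Basis ι ℝ E)
    (c : Module.Basis κ ℝ E) {B : E → E → F} (hB : IsBilinearMap ℝ B)
    (T : (E →L[ℝ] ℝ) →L[ℝ] E) :
    ∑ j, B (b j) (T (LinearMap.toContinuousLinearMap (b.coord j)))
      = ∑ i, B (c i) (T (LinearMap.toContinuousLinearMap (c.coord i))) := by
  have key : ∀ u v, B u v = hB.toLinearMap u v := fun _ _ => rfl
  have h1 : ∀ j, LinearMap.toContinuousLinearMap (b.coord j)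
      = ∑ i, b.coord j (c i) • LinearMap.toContinuousLinearMap (c.coord i) := by
    intro j
    ext x
    have h := congrArg (b.coord j) (c.sum_repr x)
    simp only [map_sum, map_smul, smul_eq_mul] at h
    simp only [LinearMap.coe_toContinuousLinearMap', sum_apply, smul_apply, smul_eq_mul, ← h]
    exact Finset.sum_congr rfl fun i _ => mul_comm _ _
  have h2 : ∀ i, c i = ∑ j, b.coord j (c i) • b j := fun i => (b.sum_repr (c i)).symm
  simp only [key]
  calc ∑ j, hB.toLinearMap (b j) (T (LinearMap.toContinuousLinearMap (b.coord j)))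
      = ∑ j, ∑ i, b.coord j (c i) •
          hB.toLinearMap (b j) (T (LinearMap.toContinuousLinearMap (c.coord i))) := by
        refine Finset.sum_congr rfl fun j _ => ?_
        rw [h1 j]; simp only [map_sum, map_smul]
    _ = ∑ i, ∑ j, b.coord j (c i) •
          hB.toLinearMap (b j) (T (LinearMap.toContinuousLinearMap (c.coord i))) :=
        Finset.sum_comm
    _ = _ := by
        refine Finset.sum_congr rfl fun i _ => ?_
        conv_rhs => rw [h2 i]
        simp only [map_sum, map_smul, LinearMap.sum_apply, LinearMap.smul_apply]

lemma metricTrace_eq_sum {ι : Type*} [Fintype ι] (b : Module.Basis ι ℝ E)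
    (G : E → E →L[ℝ] E →L[ℝ] ℝ) (p : E) {B : E → E → F} (hB : IsBilinearMap ℝ B) :
    metricTrace G p B
      = ∑ i, B (b i) ((G p).inverse (LinearMap.toContinuousLinearMap (b.coord i))) :=
  sum_basis_coord_eq _ b hB _

omit [Module ℝ F] in
lemma metricTrace_add (G : E → E →L[ℝ] E →L[ℝ] ℝ) (p : E) (B C : E → E → F) :
    metricTrace G p (fun u v => B u v + C u v) = metricTrace G p B + metricTrace G p C :=
  Finset.sum_add_distrib

lemma metricTrace_smul (G : E → E →L[ℝ] E →L[ℝ] ℝ) (p : E) (c : ℝ) (B : E → E → F) :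
    metricTrace G p (fun u v => c • B u v) = c • metricTrace G p B :=
  Finset.smul_sum.symm

omit [Module ℝ F] in
lemma metricTrace_congr {G G' : E → E →L[ℝ] E →L[ℝ] ℝ} {p : E} (h : G p = G' p)
    {B C : E → E → F} (hBC : ∀ u v, B u v = C u v) :
    metricTrace G p B = metricTrace G' p C := by
  simp only [metricTrace, h, hBC]

omit [Module ℝ F] in
lemma metricTrace_prodMk {F' : Type*} [AddCommGroup F'] (G : E → E →L[ℝ] E →L[ℝ] ℝ) (p : E)
    (B : E → E → F) (C : E → E → F') :
    metricTrace G p (fun u v => (B u v, C u v)) = (metricTrace G p B, metricTrace G p C) := by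
  ext <;> simp [metricTrace, Prod.fst_sum, Prod.snd_sum]

lemma metricTrace_self {G : E → E →L[ℝ] E →L[ℝ] ℝ} {p : E} (hs : ∀ u v, G p u v = G p v u)
    (hG : (G p).IsInvertible) :
    metricTrace G p (fun u v => G p u v) = Module.finrank ℝ E := by
  simp only [metricTrace, hs (Module.finBasis ℝ E _), hG.self_apply_inverse]
  simp

lemma isInvertible_of_injective {T : E →L[ℝ] E →L[ℝ] ℝ} (hT : Function.Injective T) :
    T.IsInvertible := by
  have hfr : Module.finrank ℝ E = Module.finrank ℝ (E →L[ℝ] ℝ) := by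
    rw [← LinearEquiv.finrank_eq (LinearMap.toContinuousLinearMap (𝕜 := ℝ) (E := E) (F' := ℝ))]
    exact (Subspace.dual_finrank_eq (K := ℝ) (V := E)).symm
  exact ⟨(LinearMap.linearEquivOfInjective T.toLinearMap hT hfr).toContinuousLinearEquiv, by
    ext; rfl⟩

end Trace

/-! ### Warped metrics in coordinates -/

section Warped

variable {E : Type*} [NormedAddCommGroup E] [NormedSpace ℝ E]

/-- `G` is a smooth nondegenerate metric in coordinates ranging over `S`. -/
structure IsLocalMetric (G : E → E →L[ℝ] E →L[ℝ] ℝ) (S : Set E) : Prop where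
  contDiffOn : ContDiffOn ℝ ∞ G S
  symm : ∀ p ∈ S, ∀ u v, G p u v = G p v u
  isInvertible : ∀ p ∈ S, (G p).IsInvertible

/-- The metric `dr² + σ(r)² G` in coordinates. -/
def localWarp (σ : ℝ → ℝ) (G : E → E →L[ℝ] E →L[ℝ] ℝ) (x : ℝ × E) :
    ℝ × E →L[ℝ] ℝ × E →L[ℝ] ℝ :=
  (ContinuousLinearMap.mul ℝ ℝ).bilinearComp (.fst ℝ ℝ E) (.fst ℝ ℝ E)
    + (σ x.1) ^ 2 • (G x.2).bilinearComp (.snd ℝ ℝ E) (.snd ℝ ℝ E)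

@[simp] lemma localWarp_apply (σ : ℝ → ℝ) (G : E → E →L[ℝ] E →L[ℝ] ℝ) (x u v : ℝ × E) :
    localWarp σ G x u v = u.1 * v.1 + σ x.1 ^ 2 * G x.2 u.2 v.2 := rfl

lemma isInvertible_localWarp [FiniteDimensional ℝ E] {σ : ℝ → ℝ} {G : E → E →L[ℝ] E →L[ℝ] ℝ}
    {x : ℝ × E} (hσ : σ x.1 ≠ 0) (hG : (G x.2).IsInvertible) :
    (localWarp σ G x).IsInvertible := by
  refine isInvertible_of_injective ((injective_iff_map_eq_zero _).2 fun u hu => ?_)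
  have h : ∀ v : ℝ × E, u.1 * v.1 + σ x.1 ^ 2 * G x.2 u.2 v.2 = 0 := fun v => by
    rw [← localWarp_apply, hu]; rfl
  have h1 : u.1 = 0 := by simpa using h (1, 0)
  have h2 : G x.2 u.2 = 0 := by
    ext w
    simpa [hσ] using h (0, w)
  exact Prod.ext h1 ((injective_iff_map_eq_zero _).1 hG.injective _ h2)

lemma isLocalMetric_localWarp [FiniteDimensional ℝ E] {σ : ℝ → ℝ} {U : Set ℝ}
    {G : E → E →L[ℝ] E →L[ℝ] ℝ} {S : Set E} (hσ : ContDiffOn ℝ ∞ σ U) (hσ0 : ∀ r ∈ U, σ r ≠ 0)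
    (hG : IsLocalMetric G S) : IsLocalMetric (localWarp σ G) (U ×ˢ S) where
  contDiffOn := by
    refine contDiffOn_clm_apply.2 fun u => contDiffOn_clm_apply.2 fun v => ?_
    simp only [localWarp_apply]
    refine contDiffOn_const.add (((hσ.comp contDiffOn_fst fun x hx => hx.1).pow 2).mul ?_)
    exact ((hG.contDiffOn.comp contDiffOn_snd fun x hx => hx.2).clm_apply
      contDiffOn_const).clm_apply contDiffOn_const
  symm p hp u v := by simp [hG.symm _ hp.2 u.2, mul_comm]
  isInvertible p hp := isInvertible_localWarp (hσ0 _ hp.1) (hG.isInvertible _ hp.2)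

/-- The trace with respect to `dr² + σ(r)² G`. -/
lemma metricTrace_localWarp [FiniteDimensional ℝ E] {F : Type*} [AddCommGroup F] [Module ℝ F]
    {σ : ℝ → ℝ} {G : E → E →L[ℝ] E →L[ℝ] ℝ}
    {x : ℝ × E} (hσ : σ x.1 ≠ 0) (hG : (G x.2).IsInvertible) {B : ℝ × E → ℝ × E → F}
    (hB : IsBilinearMap ℝ B) :
    metricTrace (localWarp σ G) x B = B (1, 0) (1, 0)
      + (σ x.1 ^ 2)⁻¹ • metricTrace G x.2 (fun ξ η => B (0, ξ) (0, η)) := by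
  have hW := isInvertible_localWarp hσ hG
  rw [metricTrace_eq_sum ((Module.Basis.singleton Unit ℝ).prod (Module.finBasis ℝ E)) _ _ hB,
    Fintype.sum_sum_type, metricTrace, Finset.smul_sum]
  congr 1
  · simp only [Finset.univ_unique, Finset.sum_singleton]
    congr 1
    · simp
    · rw [hW.inverse_apply_eq]
      ext w <;> simp
  · refine Finset.sum_congr rfl fun j _ => ?_
    rw [← hB.smul_right]
    congr 1
    · simp
    · rw [hW.inverse_apply_eq]
      ext w
      · simp
      · simp [hG.self_apply_inverse, hσ]

/-! ### Derivatives of functions on a product -/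

lemma hasFDerivAt_comp_fst {F : Type*} [NormedAddCommGroup F] [NormedSpace ℝ F] {f : ℝ → F}
    {x : ℝ × E} (hf : DifferentiableAt ℝ f x.1) :
    HasFDerivAt (fun y : ℝ × E => f y.1)
      ((ContinuousLinearMap.fst ℝ ℝ E).smulRight (deriv f x.1)) x := by
  refine (hf.hasDerivAt.hasFDerivAt.comp x hasFDerivAt_fst).congr_fderiv ?_
  ext <;> simp

lemma hasFDerivAt_comp_snd {F : Type*} [NormedAddCommGroup F] [NormedSpace ℝ F] {f : E → F}
    {x : ℝ × E} (hf : DifferentiableAt ℝ f x.2) :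
    HasFDerivAt (fun y : ℝ × E => f y.2) ((fderiv ℝ f x.2).comp (.snd ℝ ℝ E)) x :=
  hf.hasFDerivAt.comp x hasFDerivAt_snd

lemma fderiv_clm_apply_const {X F F' : Type*} [NormedAddCommGroup X] [NormedSpace ℝ X]
    [NormedAddCommGroup F] [NormedSpace ℝ F] [NormedAddCommGroup F'] [NormedSpace ℝ F']
    {f : X → F →L[ℝ] F'} {p : X} (hf : DifferentiableAt ℝ f p) (u : X) (v : F) :
    fderiv ℝ (fun x => f x v) p u = fderiv ℝ f p u v := by
  rw [fderiv_clm_apply hf (differentiableAt_const v)]; simp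

/-! ### Christoffel symbols -/

lemma christoffel_eq_iff {G : E → E →L[ℝ] E →L[ℝ] ℝ} {p u v X : E} (hG : (G p).IsInvertible) :
    christoffel G p u v = X ↔ ∀ w, (1 / 2 : ℝ) * (fderiv ℝ G p u v w + fderiv ℝ G p v u w
      - fderiv ℝ G p w u v) = G p X w := by
  rw [christoffel, hG.inverse_apply_eq, ContinuousLinearMap.ext_iff]
  simp

lemma isBilinearMap_christoffel (G : E → E →L[ℝ] E →L[ℝ] ℝ) (p : E) :
    IsBilinearMap ℝ (christoffel G p) := by
  constructor <;> intros <;> simp only [christoffel, ← map_add, ← map_smul] <;> congr 1 <;> ext w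
    <;> simp <;> ring

lemma contDiffOn_christoffel [FiniteDimensional ℝ E] {G : E → E →L[ℝ] E →L[ℝ] ℝ} {S : Set E}
    (hS : IsOpen S) (hG : IsLocalMetric G S) (u v : E) :
    ContDiffOn ℝ ∞ (fun x => christoffel G x u v) S := by
  have : CompleteSpace E := FiniteDimensional.complete ℝ E
  have hD : ∀ a b c : E, ContDiffOn ℝ ∞ (fun x => fderiv ℝ G x a b c) S := fun a b c =>
    (((hG.contDiffOn.fderiv_of_isOpen hS (by simp)).clm_apply contDiffOn_const).clm_apply
      contDiffOn_const).clm_apply contDiffOn_const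
  have hI : ContDiffOn ℝ ∞ (fun x => (G x).inverse) S := fun p hp =>
    ((hG.isInvertible p hp).contDiffAt_map_inverse).comp_contDiffWithinAt p (hG.contDiffOn p hp)
  refine hI.clm_apply (contDiffOn_clm_apply.2 fun w => ?_)
  exact (((hD _ _ _).add (hD _ _ _)).sub (hD _ _ _)).const_smul (1 / 2 : ℝ)

lemma fderiv_localWarp {σ : ℝ → ℝ} {G : E → E →L[ℝ] E →L[ℝ] ℝ} {x : ℝ × E}
    (hσ : DifferentiableAt ℝ σ x.1) (hG : DifferentiableAt ℝ G x.2)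
    (hW : DifferentiableAt ℝ (localWarp σ G) x) (u v w : ℝ × E) :
    fderiv ℝ (localWarp σ G) x u v w = 2 * σ x.1 * deriv σ x.1 * u.1 * G x.2 v.2 w.2
      + σ x.1 ^ 2 * fderiv ℝ G x.2 u.2 v.2 w.2 := by
  rw [← fderiv_clm_apply_const hW,
    ← fderiv_clm_apply_const (hW.clm_apply (differentiableAt_const v))]
  simp only [localWarp_apply]
  have h := (((hasFDerivAt_comp_fst hσ).pow 2).mul
    (((hasFDerivAt_comp_snd hG).clm_apply (hasFDerivAt_const v.2 x)).clm_apply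
      (hasFDerivAt_const w.2 x))).const_add (v.1 * w.1)
  refine (DFunLike.congr_fun h.fderiv u).trans ?_
  simp
  ring

/-- The Christoffel symbols of `dr² + σ(r)² G`. -/
lemma christoffel_localWarp [FiniteDimensional ℝ E] {σ : ℝ → ℝ} {U : Set ℝ} (hU : IsOpen U)
    {G : E → E →L[ℝ] E →L[ℝ] ℝ} {S : Set E} (hS : IsOpen S) (hσ : ContDiffOn ℝ ∞ σ U)
    (hσ0 : ∀ r ∈ U, σ r ≠ 0) (hG : IsLocalMetric G S) {x : ℝ × E} (hx : x ∈ U ×ˢ S)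
    (u v : ℝ × E) :
    christoffel (localWarp σ G) x u v =
      (-(σ x.1 * deriv σ x.1) * G x.2 u.2 v.2,
        (deriv σ x.1 / σ x.1) • (u.1 • v.2 + v.1 • u.2) + christoffel G x.2 u.2 v.2) := by
  have hW := isLocalMetric_localWarp hσ hσ0 hG
  have h0 := hσ0 _ hx.1
  have dσ : DifferentiableAt ℝ σ x.1 :=
    (hσ.contDiffAt (hU.mem_nhds hx.1)).differentiableAt (by simp)
  have dG : DifferentiableAt ℝ G x.2 :=
    (hG.contDiffOn.contDiffAt (hS.mem_nhds hx.2)).differentiableAt (by simp)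
  have dW : DifferentiableAt ℝ (localWarp σ G) x :=
    (hW.contDiffOn.contDiffAt ((hU.prod hS).mem_nhds hx)).differentiableAt (by simp)
  rw [christoffel_eq_iff (hW.isInvertible x hx)]
  intro w
  have hΓ := (christoffel_eq_iff (hG.isInvertible _ hx.2)).1
    (rfl : christoffel G x.2 u.2 v.2 = _) w.2
  simp only [fderiv_localWarp dσ dG dW, localWarp_apply, map_add, map_smul,
    add_apply, smul_apply, ← hΓ, smul_eq_mul]
  field_simp
  ring

end Warped

/-! ### Locality -/

section Congr

variable {E : Type*} [NormedAddCommGroup E] [NormedSpace ℝ E]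
variable {E' : Type*} [NormedAddCommGroup E'] [NormedSpace ℝ E']

lemma Filter.EventuallyEq.christoffel {G₁ G₂ : E → E →L[ℝ] E →L[ℝ] ℝ} {p : E}
    (h : G₁ =ᶠ[𝓝 p] G₂) : _root_.christoffel G₁ =ᶠ[𝓝 p] _root_.christoffel G₂ := by
  filter_upwards [h, h.fderiv (𝕜 := ℝ)] with x h1 h2
  funext u v
  simp only [_root_.christoffel, h1, h2]

lemma curvature_congr {G₁ G₂ : E → E →L[ℝ] E →L[ℝ] ℝ} {p : E} (h : G₁ =ᶠ[𝓝 p] G₂) :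
    curvature G₁ p = curvature G₂ p := by
  have hc := h.christoffel
  funext u v w
  have hf : ∀ a b : E, fderiv ℝ (fun x => christoffel G₁ x a b) p
      = fderiv ℝ (fun x => christoffel G₂ x a b) p := fun a b =>
    EventuallyEq.fderiv_eq (hc.mono fun x hx => by simp only [hx])
  simp only [curvature, hf, hc.eq_of_nhds]

lemma covDerivAlong_congr {H₁ H₂ : E' → E' →L[ℝ] E' →L[ℝ] ℝ} {f₁ f₂ X₁ X₂ : E → E'} {p : E}
    (hf : f₁ =ᶠ[𝓝 p] f₂) (hX : X₁ =ᶠ[𝓝 p] X₂) (hH : ∀ᶠ x in 𝓝 p, H₁ =ᶠ[𝓝 (f₂ x)] H₂) (u : E) :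
    covDerivAlong H₁ f₁ X₁ u =ᶠ[𝓝 p] covDerivAlong H₂ f₂ X₂ u := by
  filter_upwards [hf, hX, hf.fderiv (𝕜 := ℝ), hX.fderiv (𝕜 := ℝ), hH] with x h1 h2 h3 h4 h5
  simp only [covDerivAlong, h1, h2, h3, h4, h5.christoffel.eq_of_nhds]

variable [FiniteDimensional ℝ E]

lemma localTension_congr {G₁ G₂ : E → E →L[ℝ] E →L[ℝ] ℝ} {H₁ H₂ : E' → E' →L[ℝ] E' →L[ℝ] ℝ}
    {f₁ f₂ : E → E'} {p : E} (hG : G₁ =ᶠ[𝓝 p] G₂) (hf : f₁ =ᶠ[𝓝 p] f₂)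
    (hH : ∀ᶠ x in 𝓝 p, H₁ =ᶠ[𝓝 (f₂ x)] H₂) :
    localTension G₁ H₁ f₁ =ᶠ[𝓝 p] localTension G₂ H₂ f₂ := by
  filter_upwards [hG.eventuallyEq_nhds, hf.eventuallyEq_nhds, hH.eventually_nhds] with x h1 h2 h3
  refine metricTrace_congr h1.eq_of_nhds fun u v => ?_
  have h4 : (fun y => fderiv ℝ f₁ y v) =ᶠ[𝓝 x] fun y => fderiv ℝ f₂ y v :=
    (h2.fderiv (𝕜 := ℝ)).mono fun y hy => by simp only [hy]
  rw [(covDerivAlong_congr h2 h4 h3 u).eq_of_nhds, h2.fderiv_eq, h1.christoffel.eq_of_nhds]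

lemma localBitension_congr {G₁ G₂ : E → E →L[ℝ] E →L[ℝ] ℝ} {H₁ H₂ : E' → E' →L[ℝ] E' →L[ℝ] ℝ}
    {f₁ f₂ : E → E'} {p : E} (hG : G₁ =ᶠ[𝓝 p] G₂) (hf : f₁ =ᶠ[𝓝 p] f₂)
    (hH : ∀ᶠ x in 𝓝 p, H₁ =ᶠ[𝓝 (f₂ x)] H₂) :
    localBitension G₁ H₁ f₁ p = localBitension G₂ H₂ f₂ p := by
  have hT := localTension_congr hG hf hH
  refine metricTrace_congr hG.eq_of_nhds fun u v => ?_
  have h1 : ∀ w, covDerivAlong H₁ f₁ (localTension G₁ H₁ f₁) w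
      =ᶠ[𝓝 p] covDerivAlong H₂ f₂ (localTension G₂ H₂ f₂) w :=
    covDerivAlong_congr hf hT hH
  rw [secondCovDerivAlong, secondCovDerivAlong, (covDerivAlong_congr hf (h1 v) hH u).eq_of_nhds,
    (h1 _).eq_of_nhds, hG.christoffel.eq_of_nhds, hf.eq_of_nhds, hf.fderiv_eq, hT.eq_of_nhds,
    curvature_congr hH.self_of_nhds]

lemma localLaplacian_congr {G₁ G₂ : E → E →L[ℝ] E →L[ℝ] ℝ} {u₁ u₂ : E → ℝ} {p : E}
    (hG : G₁ =ᶠ[𝓝 p] G₂) (hu : u₁ =ᶠ[𝓝 p] u₂) :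
    localLaplacian G₁ u₁ p = localLaplacian G₂ u₂ p := by
  refine metricTrace_congr hG.eq_of_nhds fun v w => ?_
  have h : (fun y => fderiv ℝ u₁ y w) =ᶠ[𝓝 p] fun y => fderiv ℝ u₂ y w :=
    (hu.fderiv (𝕜 := ℝ)).mono fun y hy => by simp only [hy]
  rw [h.fderiv_eq, hu.fderiv_eq, hG.christoffel.eq_of_nhds]

end Congr

/-! ### Equivariant maps in coordinates -/

section Equivariant

variable {E : Type*} [NormedAddCommGroup E] [NormedSpace ℝ E] [FiniteDimensional ℝ E]
variable {E' : Type*} [NormedAddCommGroup E'] [NormedSpace ℝ E']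

/-- The Laplacian `u'' + m (σ'/σ) u'` of functions of `r` for `dr² + σ(r)² g`, `m = dim g`. -/
def radialLaplacian (m : ℕ) (σ u : ℝ → ℝ) (r : ℝ) : ℝ :=
  deriv (deriv u) r + m * (deriv σ r / σ r) * deriv u r

/-- The radial component of the tension field of an equivariant map. -/
def radialTension (m : ℕ) (k : ℝ) (σ lam ρ : ℝ → ℝ) (r : ℝ) : ℝ :=
  radialLaplacian m σ ρ r - 2 * k * (lam (ρ r) * deriv lam (ρ r) / σ r ^ 2)

/-- The radial component of the bitension field of an equivariant map, in terms of the radial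
component `F` of the tension field. -/
def radialBitension (m : ℕ) (k : ℝ) (σ lam ρ F : ℝ → ℝ) (r : ℝ) : ℝ :=
  radialLaplacian m σ F r
    - 2 * k * (deriv (fun s => lam s * deriv lam s) (ρ r) / σ r ^ 2) * F r

lemma ContDiffOn.deriv_smooth {U : Set ℝ} (hU : IsOpen U) {f : ℝ → ℝ}
    (hf : ContDiffOn ℝ ∞ f U) : ContDiffOn ℝ ∞ (deriv f) U :=
  hf.deriv_of_isOpen hU (by simp)

lemma ContDiffOn.differentiableAt_of_isOpen {X F : Type*} [NormedAddCommGroup X] [NormedSpace ℝ X]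
    [NormedAddCommGroup F] [NormedSpace ℝ F] {U : Set X} (hU : IsOpen U) {f : X → F}
    (hf : ContDiffOn ℝ ∞ f U) {x : X} (hx : x ∈ U) : DifferentiableAt ℝ f x :=
  (hf.contDiffAt (hU.mem_nhds hx)).differentiableAt (by simp)

section Laplacian

variable {σ : ℝ → ℝ} {U : Set ℝ} {G : E → E →L[ℝ] E →L[ℝ] ℝ} {S : Set E}

lemma localLaplacian_comp_fst (hU : IsOpen U) (hS : IsOpen S) (hσ : ContDiffOn ℝ ∞ σ U)
    (hσ0 : ∀ r ∈ U, σ r ≠ 0) (hG : IsLocalMetric G S) {u : ℝ → ℝ} (hu : ContDiffOn ℝ ∞ u U)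
    {x : ℝ × E} (hx : x ∈ U ×ˢ S) :
    localLaplacian (localWarp σ G) (fun y => u y.1) x
      = radialLaplacian (Module.finrank ℝ E) σ u x.1 := by
  have hu' := hu.deriv_smooth hU
  have h1 : ∀ y ∈ U ×ˢ S, ∀ w : ℝ × E, fderiv ℝ (fun y : ℝ × E => u y.1) y w
      = w.1 * deriv u y.1 := fun y hy w => by
    rw [(hasFDerivAt_comp_fst (hu.differentiableAt_of_isOpen hU hy.1)).fderiv]; simp
  have h2 : ∀ v w : ℝ × E, fderiv ℝ (fun y => fderiv ℝ (fun y : ℝ × E => u y.1) y w) x v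
      = v.1 * w.1 * deriv (deriv u) x.1 := fun v w => by
    have h3 : (fun y => fderiv ℝ (fun y : ℝ × E => u y.1) y w)
        =ᶠ[𝓝 x] fun y => w.1 * deriv u y.1 := by
      filter_upwards [(hU.prod hS).mem_nhds hx] with y hy using h1 y hy w
    rw [h3.fderiv_eq,
      ((hasFDerivAt_comp_fst (hu'.differentiableAt_of_isOpen hU hx.1)).const_mul w.1).fderiv]
    simp; ring
  have h0 := hσ0 _ hx.1
  have hB : ∀ v w : ℝ × E,
      fderiv ℝ (fun y => fderiv ℝ (fun y : ℝ × E => u y.1) y w) x v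
        - fderiv ℝ (fun y : ℝ × E => u y.1) x (christoffel (localWarp σ G) x v w)
      = v.1 * w.1 * deriv (deriv u) x.1
        + (σ x.1 * deriv σ x.1 * deriv u x.1) • G x.2 v.2 w.2 := fun v w => by
    rw [h2, h1 x hx, christoffel_localWarp hU hS hσ hσ0 hG hx]
    simp only [smul_eq_mul]; ring
  rw [localLaplacian, metricTrace_congr rfl hB,
    metricTrace_localWarp h0 (hG.isInvertible _ hx.2)]
  · simp only [mul_zero, zero_mul, zero_add, map_zero]
    rw [metricTrace_smul, metricTrace_self (hG.symm _ hx.2) (hG.isInvertible _ hx.2),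
      radialLaplacian]
    simp only [smul_eq_mul]
    field_simp
    ring
  · constructor <;> intros <;> simp <;> ring

end Laplacian

section Tension

variable {σ lam ρ : ℝ → ℝ} {U V : Set ℝ} {G : E → E →L[ℝ] E →L[ℝ] ℝ} {S : Set E}
  {G' : E' → E' →L[ℝ] E' →L[ℝ] ℝ} {S' : Set E'} {ψ : E → E'} {k : ℝ}

omit [FiniteDimensional ℝ E] in
lemma hasFDerivAt_prodMap {X : ℝ → ℝ} {Y : E → E'} {x : ℝ × E} (hX : DifferentiableAt ℝ X x.1)
    (hY : DifferentiableAt ℝ Y x.2) :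
    HasFDerivAt (fun y : ℝ × E => (X y.1, Y y.2))
      (((ContinuousLinearMap.fst ℝ ℝ E).smulRight (deriv X x.1)).prod
        ((fderiv ℝ Y x.2).comp (.snd ℝ ℝ E))) x :=
  (hasFDerivAt_comp_fst hX).prodMk (hasFDerivAt_comp_snd hY)

/-- The coordinate hypotheses on an equivariant map `(r, y) ↦ (ρ r, ψ y)` between warped products. -/
structure IsLocalEquivariant (σ lam ρ : ℝ → ℝ) (U V : Set ℝ) (G : E → E →L[ℝ] E →L[ℝ] ℝ)
    (S : Set E) (G' : E' → E' →L[ℝ] E' →L[ℝ] ℝ) (S' : Set E') (ψ : E → E') (k : ℝ) : Prop where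
  isOpen_U : IsOpen U
  isOpen_V : IsOpen V
  isOpen_S : IsOpen S
  isOpen_S' : IsOpen S'
  smooth_σ : ContDiffOn ℝ ∞ σ U
  σ_ne : ∀ r ∈ U, σ r ≠ 0
  smooth_lam : ContDiffOn ℝ ∞ lam V
  lam_ne : ∀ s ∈ V, lam s ≠ 0
  smooth_ρ : ContDiffOn ℝ ∞ ρ U
  mapsTo_ρ : ∀ r ∈ U, ρ r ∈ V
  metric_G : IsLocalMetric G S
  metric_G' : IsLocalMetric G' S'
  smooth_ψ : ContDiffOn ℝ ∞ ψ S
  mapsTo_ψ : ∀ y ∈ S, ψ y ∈ S'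
  tension_eq : ∀ y ∈ S, localTension G G' ψ y = 0
  energy_eq : ∀ y ∈ S, localEnergyDensity G G' ψ y = k

namespace IsLocalEquivariant

variable (h : IsLocalEquivariant σ lam ρ U V G S G' S' ψ k)
include h

lemma metricTrace_pullback {y : E} (hy : y ∈ S) :
    metricTrace G y (fun u v => G' (ψ y) (fderiv ℝ ψ y u) (fderiv ℝ ψ y v)) = 2 * k := by
  rw [← h.energy_eq y hy, localEnergyDensity]; ring

lemma fderiv_fderiv_apply {y : E} (hy : y ∈ S) (ξ η : E) :
    fderiv ℝ (fun z => fderiv ℝ ψ z η) y ξ = fderiv ℝ (fderiv ℝ ψ) y ξ η :=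
  fderiv_clm_apply_const
    ((h.smooth_ψ.fderiv_of_isOpen h.isOpen_S (by simp)).differentiableAt_of_isOpen h.isOpen_S hy) ξ η

lemma metricTrace_hessian {y : E} (hy : y ∈ S) :
    metricTrace G y (fun ξ η => fderiv ℝ (fderiv ℝ ψ) y ξ η
      + christoffel G' (ψ y) (fderiv ℝ ψ y ξ) (fderiv ℝ ψ y η)
      - fderiv ℝ ψ y (christoffel G y ξ η)) = 0 := by
  rw [← h.tension_eq y hy]
  exact metricTrace_congr rfl fun ξ η => by rw [covDerivAlong, h.fderiv_fderiv_apply hy]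

lemma fderiv_map {x : ℝ × E} (hx : x ∈ U ×ˢ S) (u : ℝ × E) :
    fderiv ℝ (fun y : ℝ × E => (ρ y.1, ψ y.2)) x u = (deriv ρ x.1 * u.1, fderiv ℝ ψ x.2 u.2) := by
  rw [(hasFDerivAt_prodMap (h.smooth_ρ.differentiableAt_of_isOpen h.isOpen_U hx.1)
    (h.smooth_ψ.differentiableAt_of_isOpen h.isOpen_S hx.2)).fderiv]
  simp [mul_comm]

lemma christoffel_source {x : ℝ × E} (hx : x ∈ U ×ˢ S) (u v : ℝ × E) :
    christoffel (localWarp σ G) x u v =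
      (-(σ x.1 * deriv σ x.1) * G x.2 u.2 v.2,
        (deriv σ x.1 / σ x.1) • (u.1 • v.2 + v.1 • u.2) + christoffel G x.2 u.2 v.2) :=
  christoffel_localWarp h.isOpen_U h.isOpen_S h.smooth_σ h.σ_ne h.metric_G hx u v

lemma christoffel_target [FiniteDimensional ℝ E'] {z : ℝ × E'} (hz : z ∈ V ×ˢ S') (u v : ℝ × E') :
    christoffel (localWarp lam G') z u v =
      (-(lam z.1 * deriv lam z.1) * G' z.2 u.2 v.2,
        (deriv lam z.1 / lam z.1) • (u.1 • v.2 + v.1 • u.2) + christoffel G' z.2 u.2 v.2) :=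
  christoffel_localWarp h.isOpen_V h.isOpen_S' h.smooth_lam h.lam_ne h.metric_G' hz u v

lemma mapsTo {x : ℝ × E} (hx : x ∈ U ×ˢ S) : (ρ x.1, ψ x.2) ∈ V ×ˢ S' :=
  ⟨h.mapsTo_ρ _ hx.1, h.mapsTo_ψ _ hx.2⟩

variable [FiniteDimensional ℝ E']

lemma localTension_eq {x : ℝ × E} (hx : x ∈ U ×ˢ S) :
    localTension (localWarp σ G) (localWarp lam G') (fun y => (ρ y.1, ψ y.2)) x
      = (radialTension (Module.finrank ℝ E) k σ lam ρ x.1, 0) := by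
  have h0 := h.σ_ne _ hx.1
  have hnhds := (h.isOpen_U.prod h.isOpen_S).mem_nhds hx
  have dρ' := (h.smooth_ρ.deriv_smooth h.isOpen_U).differentiableAt_of_isOpen
    h.isOpen_U hx.1
  have dψ' := (h.smooth_ψ.fderiv_of_isOpen (m := ∞) h.isOpen_S
    (by simp)).differentiableAt_of_isOpen h.isOpen_S hx.2
  have h2 : ∀ u v : ℝ × E,
      fderiv ℝ (fun y => fderiv ℝ (fun y : ℝ × E => (ρ y.1, ψ y.2)) y v) x u
        = (deriv (deriv ρ) x.1 * u.1 * v.1, fderiv ℝ (fderiv ℝ ψ) x.2 u.2 v.2) := fun u v => by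
    have h3 : (fun y => fderiv ℝ (fun y : ℝ × E => (ρ y.1, ψ y.2)) y v)
        =ᶠ[𝓝 x] fun y => (deriv ρ y.1 * v.1, fderiv ℝ ψ y.2 v.2) := by
      filter_upwards [hnhds] with y hy using h.fderiv_map hy v
    rw [h3.fderiv_eq, (hasFDerivAt_prodMap (X := fun r => deriv ρ r * v.1)
      (Y := fun y => fderiv ℝ ψ y v.2) (dρ'.mul_const _)
      (dψ'.clm_apply (differentiableAt_const _))).fderiv]
    simp [fderiv_clm_apply_const dψ']
    ring
  have hB : ∀ u v : ℝ × E,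
      covDerivAlong (localWarp lam G') (fun y => (ρ y.1, ψ y.2))
          (fun y => fderiv ℝ (fun y : ℝ × E => (ρ y.1, ψ y.2)) y v) u x
        - fderiv ℝ (fun y : ℝ × E => (ρ y.1, ψ y.2)) x (christoffel (localWarp σ G) x u v)
      = (deriv (deriv ρ) x.1 * u.1 * v.1
          + (-(lam (ρ x.1) * deriv lam (ρ x.1)) •
              G' (ψ x.2) (fderiv ℝ ψ x.2 u.2) (fderiv ℝ ψ x.2 v.2)
            + (σ x.1 * deriv σ x.1 * deriv ρ x.1) • G x.2 u.2 v.2),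
        (deriv lam (ρ x.1) / lam (ρ x.1) * deriv ρ x.1 - deriv σ x.1 / σ x.1) •
            (u.1 • fderiv ℝ ψ x.2 v.2 + v.1 • fderiv ℝ ψ x.2 u.2)
          + (fderiv ℝ (fderiv ℝ ψ) x.2 u.2 v.2
            + christoffel G' (ψ x.2) (fderiv ℝ ψ x.2 u.2) (fderiv ℝ ψ x.2 v.2)
            - fderiv ℝ ψ x.2 (christoffel G x.2 u.2 v.2))) := fun u v => by
    rw [covDerivAlong, h2, h.fderiv_map hx, h.fderiv_map hx, h.fderiv_map hx,
      h.christoffel_target (h.mapsTo hx), h.christoffel_source hx]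
    ext
    · simp; ring
    · simp only [map_add, map_smul]; simp; module
  have hbG := isBilinearMap_christoffel G x.2
  have hbG' := isBilinearMap_christoffel G' (ψ x.2)
  rw [localTension, metricTrace_congr rfl hB,
    metricTrace_localWarp h0 (h.metric_G.isInvertible _ hx.2)]
  · have e1 : christoffel G x.2 0 0 = 0 := by simpa using hbG.smul_left 0 0 0
    have e2 : christoffel G' (ψ x.2) 0 0 = 0 := by simpa using hbG'.smul_left 0 0 0
    simp only [mul_zero, zero_add, add_zero, zero_smul, smul_zero, map_zero, e1, e2,
      mul_one, sub_zero]
    rw [metricTrace_prodMk, h.metricTrace_hessian hx.2, metricTrace_add]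
    rw [metricTrace_smul, metricTrace_smul, h.metricTrace_pullback hx.2,
      metricTrace_self (h.metric_G.symm _ hx.2) (h.metric_G.isInvertible _ hx.2),
      radialTension, radialLaplacian]
    ext
    · simp; field_simp; ring
    · simp
  · constructor <;> intros <;> ext
    all_goals simp only [Prod.fst_add, Prod.snd_add, Prod.smul_fst, Prod.smul_snd, map_add,
      map_smul, add_apply, smul_apply, hbG.add_left, hbG.add_right, hbG.smul_left, hbG.smul_right,
      hbG'.add_left, hbG'.add_right, hbG'.smul_left, hbG'.smul_right, smul_eq_mul]
    all_goals first | module | ring1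

end IsLocalEquivariant

end Tension

end Equivariant

namespace IsLocalEquivariant

variable {E : Type*} [NormedAddCommGroup E] [NormedSpace ℝ E] [FiniteDimensional ℝ E]
variable {E' : Type*} [NormedAddCommGroup E'] [NormedSpace ℝ E'] [FiniteDimensional ℝ E']
variable {σ lam ρ : ℝ → ℝ} {U V : Set ℝ} {G : E → E →L[ℝ] E →L[ℝ] ℝ} {S : Set E}
  {G' : E' → E' →L[ℝ] E' →L[ℝ] ℝ} {S' : Set E'} {ψ : E → E'} {k : ℝ}

variable (h : IsLocalEquivariant σ lam ρ U V G S G' S' ψ k)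
include h

omit [FiniteDimensional ℝ E'] in
lemma smooth_logDeriv : ContDiffOn ℝ ∞ (fun s => deriv lam s / lam s) V :=
  (h.smooth_lam.deriv_smooth h.isOpen_V).div h.smooth_lam h.lam_ne

omit [FiniteDimensional ℝ E'] in
lemma smooth_mul_deriv : ContDiffOn ℝ ∞ (fun s => lam s * deriv lam s) V :=
  h.smooth_lam.mul (h.smooth_lam.deriv_smooth h.isOpen_V)

lemma curvature_radial {z : ℝ × E'} (hz : z ∈ V ×ˢ S') (u w : ℝ × E') (c : ℝ) :
    curvature (localWarp lam G') z u (c, 0) w =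
      ((deriv (fun s => lam s * deriv lam s) z.1 - deriv lam z.1 ^ 2) * c * G' z.2 u.2 w.2,
        -(c * (deriv (fun s => deriv lam s / lam s) z.1 + (deriv lam z.1 / lam z.1) ^ 2) * w.1)
          • u.2) := by
  have h0 := h.lam_ne _ hz.1
  have hnhds := (h.isOpen_V.prod h.isOpen_S').mem_nhds hz
  have dκ := h.smooth_logDeriv.differentiableAt_of_isOpen h.isOpen_V hz.1
  have dm := h.smooth_mul_deriv.differentiableAt_of_isOpen h.isOpen_V hz.1
  have dG : DifferentiableAt ℝ G' z.2 :=
    h.metric_G'.contDiffOn.differentiableAt_of_isOpen h.isOpen_S' hz.2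
  have dΓ : ∀ a b, DifferentiableAt ℝ (fun y => christoffel G' y a b) z.2 := fun a b =>
    (contDiffOn_christoffel h.isOpen_S' h.metric_G' a b).differentiableAt_of_isOpen h.isOpen_S' hz.2
  have hΓ : ∀ a b : ℝ × E', (fun x => christoffel (localWarp lam G') x a b) =ᶠ[𝓝 z] fun x =>
      (-(lam x.1 * deriv lam x.1) * G' x.2 a.2 b.2,
        (deriv lam x.1 / lam x.1) • (a.1 • b.2 + b.1 • a.2) + christoffel G' x.2 a.2 b.2) :=
    fun a b => by
      filter_upwards [hnhds] with x hx using h.christoffel_target hx a b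
  have hD : ∀ a b d : ℝ × E', fderiv ℝ (fun x => christoffel (localWarp lam G') x a b) z d
      = (-(deriv (fun s => lam s * deriv lam s) z.1 * d.1 * G' z.2 a.2 b.2
            + lam z.1 * deriv lam z.1 * fderiv ℝ G' z.2 d.2 a.2 b.2),
        (deriv (fun s => deriv lam s / lam s) z.1 * d.1) • (a.1 • b.2 + b.1 • a.2)
          + fderiv ℝ (fun y => christoffel G' y a.2 b.2) z.2 d.2) := fun a b d => by
    rw [(hΓ a b).fderiv_eq]
    have e1 := (hasFDerivAt_comp_fst dm).neg.mul (hasFDerivAt_comp_snd (f := fun y => G' y a.2 b.2)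
      ((dG.clm_apply (differentiableAt_const _)).clm_apply (differentiableAt_const _)))
    have e2 := ((hasFDerivAt_comp_fst dκ).smul_const (a.1 • b.2 + b.1 • a.2)).add
      (hasFDerivAt_comp_snd (dΓ a.2 b.2))
    refine (DFunLike.congr_fun (e1.prodMk e2).fderiv d).trans ?_
    have e3 : fderiv ℝ (fun y => G' y a.2 b.2) z.2 d.2 = fderiv ℝ G' z.2 d.2 a.2 b.2 := by
      rw [fderiv_clm_apply_const (dG.clm_apply (differentiableAt_const _)),
        fderiv_clm_apply_const dG]
    ext
    · simp [e3]; ring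
    · simp [mul_comm]
  have hb := isBilinearMap_christoffel G' z.2
  have e1 : ∀ a, christoffel G' z.2 0 a = 0 := fun a => by simpa using hb.smul_left 0 0 a
  have e2 : ∀ y a, christoffel G' y 0 a = 0 := fun y a => by
    simpa using (isBilinearMap_christoffel G' y).smul_left 0 0 a
  rw [curvature, hD, hD]
  simp only [h.christoffel_target hz]
  ext
  · simp [e2, hb.smul_right]
    field_simp
    ring
  · simp [e2, hb.smul_right]
    module

lemma covDerivAlong_radial {F : ℝ → ℝ} (hF : ContDiffOn ℝ ∞ F U) {x : ℝ × E} (hx : x ∈ U ×ˢ S)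
    (v : ℝ × E) :
    covDerivAlong (localWarp lam G') (fun y => (ρ y.1, ψ y.2)) (fun y => (F y.1, 0)) v x
      = (deriv F x.1 * v.1,
        (deriv lam (ρ x.1) / lam (ρ x.1) * F x.1) • fderiv ℝ ψ x.2 v.2) := by
  have e := hasFDerivAt_prodMap (Y := fun _ : E => (0 : E'))
    (hF.differentiableAt_of_isOpen h.isOpen_U hx.1) (differentiableAt_const (x := x.2) _)
  have e1 : ∀ a, christoffel G' (ψ x.2) a 0 = 0 := fun a => by
    simpa using (isBilinearMap_christoffel G' (ψ x.2)).smul_right 0 a 0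
  rw [covDerivAlong, e.fderiv, h.fderiv_map hx, h.christoffel_target (h.mapsTo hx)]
  ext
  · simp [mul_comm]
  · simp [e1, mul_smul]

lemma secondCovDerivAlong_radial {F : ℝ → ℝ} (hF : ContDiffOn ℝ ∞ F U) {X : ℝ × E → ℝ × E'}
    {x : ℝ × E} (hx : x ∈ U ×ˢ S) (hX : X =ᶠ[𝓝 x] fun y => (F y.1, 0)) (u v : ℝ × E) :
    secondCovDerivAlong (localWarp σ G) (localWarp lam G') (fun y => (ρ y.1, ψ y.2)) X x u v
      = (deriv (deriv F) x.1 * u.1 * v.1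
          + (-(deriv lam (ρ x.1) ^ 2 * F x.1) •
              G' (ψ x.2) (fderiv ℝ ψ x.2 u.2) (fderiv ℝ ψ x.2 v.2)
            + (σ x.1 * deriv σ x.1 * deriv F x.1) • G x.2 u.2 v.2),
        (deriv (fun r => deriv lam (ρ r) / lam (ρ r) * F r) x.1
            + deriv lam (ρ x.1) / lam (ρ x.1) * deriv ρ x.1 * (deriv lam (ρ x.1) / lam (ρ x.1) * F x.1)
            - deriv lam (ρ x.1) / lam (ρ x.1) * F x.1 * (deriv σ x.1 / σ x.1)) •
              (u.1 • fderiv ℝ ψ x.2 v.2)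
          + (deriv lam (ρ x.1) / lam (ρ x.1) * deriv F x.1
            - deriv lam (ρ x.1) / lam (ρ x.1) * F x.1 * (deriv σ x.1 / σ x.1)) •
              (v.1 • fderiv ℝ ψ x.2 u.2)
          + (deriv lam (ρ x.1) / lam (ρ x.1) * F x.1) • (fderiv ℝ (fderiv ℝ ψ) x.2 u.2 v.2
            + christoffel G' (ψ x.2) (fderiv ℝ ψ x.2 u.2) (fderiv ℝ ψ x.2 v.2)
            - fderiv ℝ ψ x.2 (christoffel G x.2 u.2 v.2))) := by
  have h0 := h.lam_ne _ (h.mapsTo_ρ _ hx.1)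
  have hnhds := (h.isOpen_U.prod h.isOpen_S).mem_nhds hx
  have hf : (fun y : ℝ × E => (ρ y.1, ψ y.2)) =ᶠ[𝓝 x] fun y => (ρ y.1, ψ y.2) := .rfl
  have hcov : ∀ w, covDerivAlong (localWarp lam G') (fun y => (ρ y.1, ψ y.2)) X w =ᶠ[𝓝 x]
      fun y => (deriv F y.1 * w.1,
        (deriv lam (ρ y.1) / lam (ρ y.1) * F y.1) • fderiv ℝ ψ y.2 w.2) := fun w =>
    (covDerivAlong_congr hf hX (.of_forall fun _ => .rfl) w).trans (by
      filter_upwards [hnhds] with y hy using h.covDerivAlong_radial hF hy w)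
  have dF' := (hF.deriv_smooth h.isOpen_U).differentiableAt_of_isOpen h.isOpen_U hx.1
  have dψ' := (h.smooth_ψ.fderiv_of_isOpen (m := ∞) h.isOpen_S
    (by simp)).differentiableAt_of_isOpen h.isOpen_S hx.2
  have dc : DifferentiableAt ℝ (fun r => deriv lam (ρ r) / lam (ρ r) * F r) x.1 :=
    ((h.smooth_logDeriv.comp h.smooth_ρ h.mapsTo_ρ).mul hF).differentiableAt_of_isOpen
      h.isOpen_U hx.1
  have e1 := (hasFDerivAt_comp_fst (x := x) (dF'.mul_const v.1)).prodMk
    ((hasFDerivAt_comp_fst (x := x) dc).smul (hasFDerivAt_comp_snd (f := fun y => fderiv ℝ ψ y v.2)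
      (dψ'.clm_apply (differentiableAt_const _))))
  have e2 : fderiv ℝ (covDerivAlong (localWarp lam G') (fun y => (ρ y.1, ψ y.2)) X v) x u
      = (deriv (deriv F) x.1 * u.1 * v.1,
        (deriv (fun r => deriv lam (ρ r) / lam (ρ r) * F r) x.1 * u.1) • fderiv ℝ ψ x.2 v.2
          + (deriv lam (ρ x.1) / lam (ρ x.1) * F x.1) • fderiv ℝ (fderiv ℝ ψ) x.2 u.2 v.2) := by
    rw [(hcov v).fderiv_eq]
    refine (DFunLike.congr_fun e1.fderiv u).trans ?_
    ext
    · simp; ring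
    · simp [fderiv_clm_apply_const dψ']; module
  rw [secondCovDerivAlong, (hcov _).eq_of_nhds, covDerivAlong, e2, (hcov v).eq_of_nhds,
    h.fderiv_map hx, h.christoffel_target (h.mapsTo hx), h.christoffel_source hx]
  have hbG' := isBilinearMap_christoffel G' (ψ x.2)
  ext
  · simp; field_simp; ring
  · simp only [map_add, map_smul, hbG'.smul_right]; simp; module

omit [FiniteDimensional ℝ E'] in
lemma smooth_radialTension :
    ContDiffOn ℝ ∞ (radialTension (Module.finrank ℝ E) k σ lam ρ) U := by
  have hρ' := h.smooth_ρ.deriv_smooth h.isOpen_U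
  have hσ' := h.smooth_σ.deriv_smooth h.isOpen_U
  exact ((hρ'.deriv_smooth h.isOpen_U).add
      ((contDiffOn_const.mul (hσ'.div h.smooth_σ h.σ_ne)).mul hρ')).sub
    (contDiffOn_const.mul ((h.smooth_mul_deriv.comp h.smooth_ρ h.mapsTo_ρ).div
      (h.smooth_σ.pow 2) fun r hr => pow_ne_zero 2 (h.σ_ne r hr)))

/-- The bitension field of an equivariant map is radial. -/
lemma localBitension_eq {x : ℝ × E} (hx : x ∈ U ×ˢ S) :
    localBitension (localWarp σ G) (localWarp lam G') (fun y => (ρ y.1, ψ y.2)) x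
      = (radialBitension (Module.finrank ℝ E) k σ lam ρ
          (radialTension (Module.finrank ℝ E) k σ lam ρ) x.1, 0) := by
  have h0 := h.σ_ne _ hx.1
  have hT : localTension (localWarp σ G) (localWarp lam G') (fun y => (ρ y.1, ψ y.2)) =ᶠ[𝓝 x]
      fun y => (radialTension (Module.finrank ℝ E) k σ lam ρ y.1, 0) := by
    filter_upwards [(h.isOpen_U.prod h.isOpen_S).mem_nhds hx] with y hy using h.localTension_eq hy
  set F := radialTension (Module.finrank ℝ E) k σ lam ρ
  have hF : ContDiffOn ℝ ∞ F U := h.smooth_radialTension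
  have hbG := isBilinearMap_christoffel G x.2
  have hbG' := isBilinearMap_christoffel G' (ψ x.2)
  obtain ⟨c₁, c₂, c₃, hB⟩ : ∃ c₁ c₂ c₃ : ℝ, ∀ u v : ℝ × E,
      secondCovDerivAlong (localWarp σ G) (localWarp lam G') (fun y => (ρ y.1, ψ y.2))
          (localTension (localWarp σ G) (localWarp lam G') (fun y => (ρ y.1, ψ y.2))) x u v
        - curvature (localWarp lam G') (ρ x.1, ψ x.2)
          (fderiv ℝ (fun y : ℝ × E => (ρ y.1, ψ y.2)) x u)
          (localTension (localWarp σ G) (localWarp lam G') (fun y => (ρ y.1, ψ y.2)) x)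
          (fderiv ℝ (fun y : ℝ × E => (ρ y.1, ψ y.2)) x v)
      = (deriv (deriv F) x.1 * u.1 * v.1
          + (-(deriv (fun s => lam s * deriv lam s) (ρ x.1) * F x.1) •
              G' (ψ x.2) (fderiv ℝ ψ x.2 u.2) (fderiv ℝ ψ x.2 v.2)
            + (σ x.1 * deriv σ x.1 * deriv F x.1) • G x.2 u.2 v.2),
        c₁ • (u.1 • fderiv ℝ ψ x.2 v.2) + c₂ • (v.1 • fderiv ℝ ψ x.2 u.2)
          + c₃ • (fderiv ℝ (fderiv ℝ ψ) x.2 u.2 v.2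
            + christoffel G' (ψ x.2) (fderiv ℝ ψ x.2 u.2) (fderiv ℝ ψ x.2 v.2)
            - fderiv ℝ ψ x.2 (christoffel G x.2 u.2 v.2))) := by
    refine ⟨deriv (fun r => deriv lam (ρ r) / lam (ρ r) * F r) x.1
            + deriv lam (ρ x.1) / lam (ρ x.1) * deriv ρ x.1 * (deriv lam (ρ x.1) / lam (ρ x.1) * F x.1)
            - deriv lam (ρ x.1) / lam (ρ x.1) * F x.1 * (deriv σ x.1 / σ x.1),
          deriv lam (ρ x.1) / lam (ρ x.1) * deriv F x.1
            - deriv lam (ρ x.1) / lam (ρ x.1) * F x.1 * (deriv σ x.1 / σ x.1)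
            + F x.1 * (deriv (fun s => deriv lam s / lam s) (ρ x.1)
              + (deriv lam (ρ x.1) / lam (ρ x.1)) ^ 2) * deriv ρ x.1,
          deriv lam (ρ x.1) / lam (ρ x.1) * F x.1, fun u v => ?_⟩
    rw [h.secondCovDerivAlong_radial hF hx hT, hT.eq_of_nhds, h.fderiv_map hx, h.fderiv_map hx,
      h.curvature_radial (h.mapsTo hx)]
    ext
    · simp; ring
    · simp only [Prod.snd_sub]; module
  rw [localBitension, metricTrace_congr rfl hB,
    metricTrace_localWarp h0 (h.metric_G.isInvertible _ hx.2)]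
  · have e1 : christoffel G x.2 0 0 = 0 := by simpa using hbG.smul_left 0 0 0
    have e2 : christoffel G' (ψ x.2) 0 0 = 0 := by simpa using hbG'.smul_left 0 0 0
    simp only [mul_zero, zero_add, add_zero, zero_smul, smul_zero, map_zero, e1, e2,
      mul_one, sub_zero]
    rw [metricTrace_prodMk, metricTrace_smul, h.metricTrace_hessian hx.2, metricTrace_add,
      metricTrace_smul, metricTrace_smul, h.metricTrace_pullback hx.2,
      metricTrace_self (h.metric_G.symm _ hx.2) (h.metric_G.isInvertible _ hx.2),
      radialBitension, radialLaplacian]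
    ext
    · simp; field_simp; ring
    · simp
  · constructor <;> intros <;> ext
    all_goals simp only [Prod.fst_add, Prod.snd_add, Prod.smul_fst, Prod.smul_snd, map_add,
      map_smul, add_apply, smul_apply, hbG.add_left, hbG.add_right, hbG.smul_left, hbG.smul_right,
      hbG'.add_left, hbG'.add_right, hbG'.smul_left, hbG'.smul_right, smul_eq_mul]
    all_goals first | module | ring1

end IsLocalEquivariant

/-! ### Charts of open subsets of the line -/

section Opens

variable {U : TopologicalSpace.Opens ℝ}

lemma TopologicalSpace.Opens.extChartAt_source_real (a : U) :
    (extChartAt 𝓘(ℝ, ℝ) a).source = Set.univ := by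
  rw [extChartAt_source, TopologicalSpace.Opens.chartAt_eq,
    OpenPartialHomeomorph.subtypeRestr_source, chartAt_self_eq]
  rfl

lemma TopologicalSpace.Opens.extChartAt_symm_coe (a r : U) :
    (extChartAt 𝓘(ℝ, ℝ) a).symm (r : ℝ) = r :=
  (extChartAt 𝓘(ℝ, ℝ) a).left_inv (by rw [extChartAt_source_real]; trivial)

lemma TopologicalSpace.Opens.coe_extChartAt_symm (a : U) {r : ℝ} (hr : r ∈ U) :
    ((extChartAt 𝓘(ℝ, ℝ) a).symm r : ℝ) = r :=
  congrArg Subtype.val (extChartAt_symm_coe a ⟨r, hr⟩)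

lemma TopologicalSpace.Opens.mem_extChartAt_target (a : U) {r : ℝ} (hr : r ∈ U) :
    r ∈ (extChartAt 𝓘(ℝ, ℝ) a).target :=
  (extChartAt 𝓘(ℝ, ℝ) a).map_source
    (x := ⟨r, hr⟩) (by rw [TopologicalSpace.Opens.extChartAt_source_real]; trivial)

lemma TopologicalSpace.Opens.hasMFDerivAt_extChartAt_symm (a : U) {r : ℝ} (hr : r ∈ U) :
    HasMFDerivAt 𝓘(ℝ, ℝ) 𝓘(ℝ, ℝ) (extChartAt 𝓘(ℝ, ℝ) a).symm r
      (ContinuousLinearMap.id ℝ ℝ) := by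
  refine ⟨((continuousOn_extChartAt_symm a).continuousAt
    ((isOpen_extChartAt_target a).mem_nhds (mem_extChartAt_target a hr))), ?_⟩
  refine HasFDerivAt.hasFDerivWithinAt ?_
  refine (hasFDerivAt_id r).congr_of_eventuallyEq ?_
  filter_upwards [U.isOpen.mem_nhds hr] with s hs using coe_extChartAt_symm a hs

end Opens

/-! ### The round metric in charts -/

section Round

variable {p : ℕ}

lemma nonempty_unitSphere (p : ℕ) : Nonempty (UnitSphere p) :=
  ⟨⟨EuclideanSpace.single 0 1, by simp⟩⟩

/-- The inverse of the preferred chart of the sphere, as a map into the ambient space. -/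
def sphereParam (a : UnitSphere p) (y : EuclideanSpace ℝ (Fin p)) :
    EuclideanSpace ℝ (Fin (p + 1)) :=
  ((extChartAt (𝓡 p) a).symm y : UnitSphere p)

lemma contMDiff_coe_unitSphere (p : ℕ) : ContMDiff (𝓡 p) 𝓘(ℝ, EuclideanSpace ℝ (Fin (p + 1))) ∞
    (fun x : UnitSphere p => (x : EuclideanSpace ℝ (Fin (p + 1)))) :=
  have := Fact.mk (@finrank_euclideanSpace_fin ℝ _ (p + 1))
  contMDiff_coe_sphere

lemma injective_mfderiv_coe_unitSphere (θ : UnitSphere p) :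
    Function.Injective (mfderiv (𝓡 p) 𝓘(ℝ, EuclideanSpace ℝ (Fin (p + 1)))
      (fun x : UnitSphere p => (x : EuclideanSpace ℝ (Fin (p + 1)))) θ) :=
  have := Fact.mk (@finrank_euclideanSpace_fin ℝ _ (p + 1))
  injective_mvfderiv_subtypeVal_sphere θ

lemma contDiffOn_sphereParam (a : UnitSphere p) :
    ContDiffOn ℝ ∞ (sphereParam a) (extChartAt (𝓡 p) a).target :=
  ((contMDiff_coe_unitSphere p).comp_contMDiffOn (contMDiffOn_extChartAt_symm a)).contDiffOn

lemma mdifferentiableAt_extChartAt_symm_sphere (a : UnitSphere p)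
    {y : EuclideanSpace ℝ (Fin p)} (hy : y ∈ (extChartAt (𝓡 p) a).target) :
    MDifferentiableAt 𝓘(ℝ, EuclideanSpace ℝ (Fin p)) (𝓡 p) (extChartAt (𝓡 p) a).symm y :=
  ((contMDiffOn_extChartAt_symm (n := ∞) a).contMDiffAt
    ((isOpen_extChartAt_target a).mem_nhds hy)).mdifferentiableAt (by simp)

lemma fderiv_sphereParam (a : UnitSphere p) {y : EuclideanSpace ℝ (Fin p)}
    (hy : y ∈ (extChartAt (𝓡 p) a).target) :
    fderiv ℝ (sphereParam a) y = (mfderiv (𝓡 p) 𝓘(ℝ, EuclideanSpace ℝ (Fin (p + 1)))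
        (fun x : UnitSphere p => (x : EuclideanSpace ℝ (Fin (p + 1)))) ((extChartAt (𝓡 p) a).symm y)).comp
      (mfderiv 𝓘(ℝ, EuclideanSpace ℝ (Fin p)) (𝓡 p) (extChartAt (𝓡 p) a).symm y) := by
  rw [← mfderiv_eq_fderiv]
  exact mfderiv_comp y ((contMDiff_coe_unitSphere p).mdifferentiableAt (by simp))
    (mdifferentiableAt_extChartAt_symm_sphere a hy)

lemma chartMetric_roundMetric_apply (a : UnitSphere p) {y : EuclideanSpace ℝ (Fin p)}
    (hy : y ∈ (extChartAt (𝓡 p) a).target) (u v : EuclideanSpace ℝ (Fin p)) :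
    chartMetric (roundMetric p) a y u v
      = inner ℝ (fderiv ℝ (sphereParam a) y u) (fderiv ℝ (sphereParam a) y v) := by
  rw [fderiv_sphereParam a hy]; rfl

lemma injective_fderiv_sphereParam (a : UnitSphere p) {y : EuclideanSpace ℝ (Fin p)}
    (hy : y ∈ (extChartAt (𝓡 p) a).target) :
    Function.Injective (fderiv ℝ (sphereParam a) y) := by
  rw [fderiv_sphereParam a hy]
  have h2 := (isInvertible_mfderivWithin_extChartAt_symm (I := 𝓡 p) hy).injective
  rw [ModelWithCorners.range_eq_univ, mfderivWithin_univ] at h2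
  exact (injective_mfderiv_coe_unitSphere _).comp h2

lemma isLocalMetric_chartMetric_roundMetric (a : UnitSphere p) :
    IsLocalMetric (chartMetric (roundMetric p) a) (extChartAt (𝓡 p) a).target where
  contDiffOn := by
    have hJ := (contDiffOn_sphereParam a).fderiv_of_isOpen (m := ∞)
      (isOpen_extChartAt_target a) (by simp)
    refine contDiffOn_clm_apply.2 fun u => contDiffOn_clm_apply.2 fun v => ?_
    exact ((hJ.clm_apply contDiffOn_const).inner ℝ (hJ.clm_apply contDiffOn_const)).congr
      fun y hy => chartMetric_roundMetric_apply a hy u v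
  symm y hy u v := by
    rw [chartMetric_roundMetric_apply a hy, chartMetric_roundMetric_apply a hy,
      real_inner_comm]
  isInvertible y hy := by
    refine isInvertible_of_injective ((injective_iff_map_eq_zero _).2 fun u hu => ?_)
    have h := chartMetric_roundMetric_apply a hy u u
    rw [hu, zero_apply, eq_comm, inner_self_eq_zero] at h
    exact (injective_iff_map_eq_zero _).1 (injective_fderiv_sphereParam a hy) u h

end Round

/-! ### Warped products and equivariant maps in charts -/

section Warped

variable {p q : ℕ} {U V : TopologicalSpace.Opens ℝ}

lemma chartMetric_warpedMetric (σ : ℝ → ℝ) (a : U × UnitSphere p)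
    {x : ℝ × EuclideanSpace ℝ (Fin p)}
    (hx : x ∈ (U : Set ℝ) ×ˢ (extChartAt (𝓡 p) a.2).target) :
    chartMetric (warpedMetric p U σ) a x = localWarp σ (chartMetric (roundMetric p) a.2) x := by
  have h1 : HasMFDerivAt 𝓘(ℝ, ℝ × EuclideanSpace ℝ (Fin p)) 𝓘(ℝ, ℝ)
      (fun z : ℝ × EuclideanSpace ℝ (Fin p) => (extChartAt 𝓘(ℝ, ℝ) a.1).symm z.1) x
      ((ContinuousLinearMap.id ℝ ℝ).comp (.fst ℝ ℝ _)) :=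
    (TopologicalSpace.Opens.hasMFDerivAt_extChartAt_symm a.1 hx.1).comp x
      hasFDerivAt_fst.hasMFDerivAt
  have h2 : HasMFDerivAt 𝓘(ℝ, ℝ × EuclideanSpace ℝ (Fin p)) (𝓡 p)
      (fun z : ℝ × EuclideanSpace ℝ (Fin p) => (extChartAt (𝓡 p) a.2).symm z.2) x
      (ContinuousLinearMap.comp (mfderiv 𝓘(ℝ, EuclideanSpace ℝ (Fin p)) (𝓡 p)
        (extChartAt (𝓡 p) a.2).symm x.2) (.snd ℝ ℝ (EuclideanSpace ℝ (Fin p)))) :=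
    (mdifferentiableAt_extChartAt_symm_sphere a.2 hx.2).hasMFDerivAt.comp x
      hasFDerivAt_snd.hasMFDerivAt
  have h3 : mfderiv 𝓘(ℝ, ℝ × EuclideanSpace ℝ (Fin p)) (𝓘(ℝ, ℝ).prod (𝓡 p))
      (extChartAt (𝓘(ℝ, ℝ).prod (𝓡 p)) a).symm x = _ := (h1.prodMk h2).mfderiv
  refine ContinuousLinearMap.ext fun u => ContinuousLinearMap.ext fun v => ?_
  have h4 : chartMetric (warpedMetric p U σ) a x u v
      = warpedMetric p U σ ((extChartAt (𝓘(ℝ, ℝ).prod (𝓡 p)) a).symm x)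
        (mfderiv 𝓘(ℝ, ℝ × EuclideanSpace ℝ (Fin p)) (𝓘(ℝ, ℝ).prod (𝓡 p))
          (extChartAt (𝓘(ℝ, ℝ).prod (𝓡 p)) a).symm x u)
        (mfderiv 𝓘(ℝ, ℝ × EuclideanSpace ℝ (Fin p)) (𝓘(ℝ, ℝ).prod (𝓡 p))
          (extChartAt (𝓘(ℝ, ℝ).prod (𝓡 p)) a).symm x v) := rfl
  rw [h4, h3, localWarp_apply]
  have h5 : σ ((extChartAt 𝓘(ℝ, ℝ) a.1).symm x.1) = σ x.1 := by
    rw [TopologicalSpace.Opens.coe_extChartAt_symm a.1 hx.1]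
  rw [← h5]
  rfl

lemma isOpen_chartMap_domain {φ : UnitSphere p → UnitSphere q} (hφ : Continuous φ)
    (a : UnitSphere p) (b : UnitSphere q) :
    IsOpen ((extChartAt (𝓡 p) a).target ∩
      (extChartAt (𝓡 p) a).symm ⁻¹' (φ ⁻¹' (extChartAt (𝓡 q) b).source)) :=
  (continuousOn_extChartAt_symm a).isOpen_inter_preimage (isOpen_extChartAt_target a)
    ((isOpen_extChartAt_source b).preimage hφ)

variable {σ lam ρ : ℝ → ℝ} {k : ℝ} {φ : UnitSphere p → UnitSphere q}

lemma isLocalEquivariant_chartMap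
    (hσ : ContDiffOn ℝ ∞ σ U) (hσ_pos : ∀ r ∈ U, 0 < σ r)
    (hlam : ContDiffOn ℝ ∞ lam V) (hlam_pos : ∀ s ∈ V, 0 < lam s)
    (hρ : ContDiffOn ℝ ∞ ρ U) (hρV : ∀ r ∈ U, ρ r ∈ V) (hφ : IsEigenmap p q φ k)
    (a : UnitSphere p) (b : UnitSphere q) :
    IsLocalEquivariant σ lam ρ U V (chartMetric (roundMetric p) a)
      ((extChartAt (𝓡 p) a).target ∩
        (extChartAt (𝓡 p) a).symm ⁻¹' (φ ⁻¹' (extChartAt (𝓡 q) b).source))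
      (chartMetric (roundMetric q) b) (extChartAt (𝓡 q) b).target
      (chartMap (𝓡 p) (𝓡 q) φ a b) k where
  isOpen_U := U.isOpen
  isOpen_V := V.isOpen
  isOpen_S := isOpen_chartMap_domain hφ.1.1.continuous a b
  isOpen_S' := isOpen_extChartAt_target b
  smooth_σ := hσ
  σ_ne r hr := (hσ_pos r hr).ne'
  smooth_lam := hlam
  lam_ne s hs := (hlam_pos s hs).ne'
  smooth_ρ := hρ
  mapsTo_ρ := hρV
  metric_G :=
    { contDiffOn := (isLocalMetric_chartMetric_roundMetric a).contDiffOn.mono Set.inter_subset_left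
      symm := fun y hy => (isLocalMetric_chartMetric_roundMetric a).symm y hy.1
      isInvertible := fun y hy => (isLocalMetric_chartMetric_roundMetric a).isInvertible y hy.1 }
  metric_G' := isLocalMetric_chartMetric_roundMetric b
  smooth_ψ :=
    (((contMDiffOn_extChartAt (n := ∞) (x := b)).comp
      (hφ.1.1.comp_contMDiffOn ((contMDiffOn_extChartAt_symm a).mono Set.inter_subset_left))
      fun y hy => by
        rw [Set.mem_preimage, ← extChartAt_source (𝓡 q)]; exact hy.2)).contDiffOn
  mapsTo_ψ y hy := (extChartAt (𝓡 q) b).map_source hy.2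
  tension_eq y hy := by
    have h := hφ.1.2 a b _ ((extChartAt (𝓡 p) a).map_target hy.1) hy.2
    rwa [(extChartAt (𝓡 p) a).right_inv hy.1] at h
  energy_eq y hy := by
    have h := hφ.2 a b _ ((extChartAt (𝓡 p) a).map_target hy.1) hy.2
    rwa [(extChartAt (𝓡 p) a).right_inv hy.1] at h

lemma contMDiff_equivariantMap (hρ : ContDiffOn ℝ ∞ ρ U) (hρV : ∀ r ∈ U, ρ r ∈ V)
    (hφ : ContMDiff (𝓡 p) (𝓡 q) ∞ φ) :
    ContMDiff (𝓘(ℝ, ℝ).prod (𝓡 p)) (𝓘(ℝ, ℝ).prod (𝓡 q)) ∞ (equivariantMap ρ hρV φ) := by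
  have h : ContMDiff 𝓘(ℝ, ℝ) 𝓘(ℝ, ℝ) ∞ (fun r : U => (⟨ρ r, hρV r r.2⟩ : V)) := by
    rw [← ContMDiff.subtypeVal_comp_iff]
    intro r
    exact contMDiffAt_subtype_iff.2 (hρ.contDiffAt (U.isOpen.mem_nhds r.2)).contMDiffAt
  exact h.prodMap hφ

lemma localBitension_equivariantMap
    (hσ : ContDiffOn ℝ ∞ σ U) (hσ_pos : ∀ r ∈ U, 0 < σ r)
    (hlam : ContDiffOn ℝ ∞ lam V) (hlam_pos : ∀ s ∈ V, 0 < lam s)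
    (hρ : ContDiffOn ℝ ∞ ρ U) (hρV : ∀ r ∈ U, ρ r ∈ V) (hφ : IsEigenmap p q φ k)
    (a : U × UnitSphere p) (b : V × UnitSphere q) {x : U × UnitSphere p}
    (hx : x.2 ∈ (extChartAt (𝓡 p) a.2).source) (hb : φ x.2 ∈ (extChartAt (𝓡 q) b.2).source) :
    localBitension (chartMetric (warpedMetric p U σ) a) (chartMetric (warpedMetric q V lam) b)
      (chartMap (𝓘(ℝ, ℝ).prod (𝓡 p)) (𝓘(ℝ, ℝ).prod (𝓡 q)) (equivariantMap ρ hρV φ) a b)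
      (extChartAt (𝓘(ℝ, ℝ).prod (𝓡 p)) a x)
      = (radialBitension p k σ lam ρ (radialTension p k σ lam ρ) x.1, 0) := by
  have h := isLocalEquivariant_chartMap hσ hσ_pos hlam hlam_pos hρ hρV hφ a.2 b.2
  set S := (extChartAt (𝓡 p) a.2).target ∩
    (extChartAt (𝓡 p) a.2).symm ⁻¹' (φ ⁻¹' (extChartAt (𝓡 q) b.2).source)
  have hP : extChartAt (𝓘(ℝ, ℝ).prod (𝓡 p)) a x = ((x.1 : ℝ), extChartAt (𝓡 p) a.2 x.2) := rfl
  have hmem : ((x.1 : ℝ), extChartAt (𝓡 p) a.2 x.2) ∈ (U : Set ℝ) ×ˢ S :=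
    ⟨x.1.2, (extChartAt (𝓡 p) a.2).map_source hx, by
      simpa only [Set.mem_preimage, (extChartAt (𝓡 p) a.2).left_inv hx] using hb⟩
  have hnhds := (h.isOpen_U.prod h.isOpen_S).mem_nhds hmem
  rw [hP, localBitension_congr (G₂ := localWarp σ (chartMetric (roundMetric p) a.2))
    (H₂ := localWarp lam (chartMetric (roundMetric q) b.2))
    (f₂ := fun y => (ρ y.1, chartMap (𝓡 p) (𝓡 q) φ a.2 b.2 y.2)), h.localBitension_eq hmem]
  · simp only [finrank_euclideanSpace_fin]
  · filter_upwards [hnhds] with y hy using chartMetric_warpedMetric σ a ⟨hy.1, hy.2.1⟩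
  · filter_upwards [hnhds] with y hy
    refine Prod.ext ?_ rfl
    exact congrArg ρ (TopologicalSpace.Opens.coe_extChartAt_symm a.1 hy.1)
  · filter_upwards [hnhds] with y hy
    filter_upwards [(h.isOpen_V.prod h.isOpen_S').mem_nhds (h.mapsTo hy)] with z hz using
      chartMetric_warpedMetric lam b hz

lemma isBiharmonicMap_equivariantMap_iff
    (hσ : ContDiffOn ℝ ∞ σ U) (hσ_pos : ∀ r ∈ U, 0 < σ r)
    (hlam : ContDiffOn ℝ ∞ lam V) (hlam_pos : ∀ s ∈ V, 0 < lam s)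
    (hρ : ContDiffOn ℝ ∞ ρ U) (hρV : ∀ r ∈ U, ρ r ∈ V) (hφ : IsEigenmap p q φ k) :
    IsBiharmonicMap (warpedMetric p U σ) (warpedMetric q V lam) (equivariantMap ρ hρV φ) ↔
      ∀ r ∈ U, radialBitension p k σ lam ρ (radialTension p k σ lam ρ) r = 0 := by
  have key := localBitension_equivariantMap hσ hσ_pos hlam hlam_pos hρ hρV hφ
  constructor
  · rintro ⟨-, h⟩ r hr
    obtain ⟨θ⟩ := nonempty_unitSphere p
    have h0 := h (⟨r, hr⟩, θ) (equivariantMap ρ hρV φ (⟨r, hr⟩, θ)) (⟨r, hr⟩, θ)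
      (mem_extChartAt_source _) (mem_extChartAt_source _)
    have h1 := key (⟨r, hr⟩, θ) (equivariantMap ρ hρV φ (⟨r, hr⟩, θ)) (x := (⟨r, hr⟩, θ))
      (mem_extChartAt_source θ) (mem_extChartAt_source (φ θ))
    exact congrArg Prod.fst (h1.symm.trans h0)
  · refine fun h => ⟨contMDiff_equivariantMap hρ hρV hφ.1.1, fun a b x hx hb => ?_⟩
    rw [extChartAt_prod, PartialEquiv.prod_source] at hx hb
    have hx2 : x.2 ∈ (extChartAt (𝓡 p) a.2).source := hx.2
    have hb2 : φ x.2 ∈ (extChartAt (𝓡 q) b.2).source := hb.2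
    have h0 := h x.1 x.1.2
    rw [key a b hx2 hb2, h0]
    rfl

lemma laplaceBeltrami_radial (hσ : ContDiffOn ℝ ∞ σ U) (hσ_pos : ∀ r ∈ U, 0 < σ r) {u : ℝ → ℝ}
    (hu : ContDiffOn ℝ ∞ u U) (x : U × UnitSphere p) :
    laplaceBeltrami (warpedMetric p U σ) (fun y => u y.1) x = radialLaplacian p σ u x.1 := by
  have hmem : ((x.1 : ℝ), extChartAt (𝓡 p) x.2 x.2) ∈
      (U : Set ℝ) ×ˢ (extChartAt (𝓡 p) x.2).target := ⟨x.1.2, mem_extChartAt_target x.2⟩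
  have hnhds := (U.isOpen.prod (isOpen_extChartAt_target (I := 𝓡 p) x.2)).mem_nhds hmem
  have hP : extChartAt (𝓘(ℝ, ℝ).prod (𝓡 p)) x x = ((x.1 : ℝ), extChartAt (𝓡 p) x.2 x.2) := rfl
  rw [laplaceBeltrami, hP,
    localLaplacian_congr (G₂ := localWarp σ (chartMetric (roundMetric p) x.2))
      (u₂ := fun y => u y.1),
    localLaplacian_comp_fst U.isOpen (isOpen_extChartAt_target x.2) hσ
      (fun r hr => (hσ_pos r hr).ne') (isLocalMetric_chartMetric_roundMetric x.2) hu hmem]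
  · simp only [finrank_euclideanSpace_fin]
  · filter_upwards [hnhds] with y hy using chartMetric_warpedMetric σ x hy
  · filter_upwards [hnhds] with y hy
    exact congrArg u (TopologicalSpace.Opens.coe_extChartAt_symm x.1 hy.1)

end Warped

/-! ### The radial equations -/

section Radial

variable {U : Set ℝ} {σ : ℝ → ℝ}

lemma contDiffOn_radialLaplacian (m : ℕ) (hU : IsOpen U) (hσ : ContDiffOn ℝ ∞ σ U)
    (hσ0 : ∀ r ∈ U, σ r ≠ 0) {u : ℝ → ℝ} (hu : ContDiffOn ℝ ∞ u U) :
    ContDiffOn ℝ ∞ (radialLaplacian m σ u) U :=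
  ((hu.deriv_smooth hU).deriv_smooth hU).add
    ((contDiffOn_const.mul ((hσ.deriv_smooth hU).div hσ hσ0)).mul (hu.deriv_smooth hU))

lemma radialLaplacian_congr (m : ℕ) (hU : IsOpen U) {u v : ℝ → ℝ} (h : Set.EqOn u v U) {r : ℝ}
    (hr : r ∈ U) : radialLaplacian m σ u r = radialLaplacian m σ v r := by
  have h0 : u =ᶠ[𝓝 r] v := h.eventuallyEq_of_mem (hU.mem_nhds hr)
  rw [radialLaplacian, radialLaplacian, h0.deriv.deriv_eq, h0.deriv_eq]

lemma radialLaplacian_sub_const_mul (m : ℕ) (hU : IsOpen U) {u v : ℝ → ℝ}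
    (hu : ContDiffOn ℝ ∞ u U) (hv : ContDiffOn ℝ ∞ v U) (c : ℝ) {r : ℝ} (hr : r ∈ U) :
    radialLaplacian m σ (fun s => u s - c * v s) r
      = radialLaplacian m σ u r - c * radialLaplacian m σ v r := by
  have h1 : ∀ {f g : ℝ → ℝ}, ContDiffOn ℝ ∞ f U → ContDiffOn ℝ ∞ g U → ∀ s ∈ U,
      deriv (fun s => f s - c * g s) s = deriv f s - c * deriv g s := fun hf hg s hs => by
    have df := hf.differentiableAt_of_isOpen hU hs
    have dg := hg.differentiableAt_of_isOpen hU hs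
    rw [deriv_fun_sub df (dg.const_mul c), deriv_const_mul _ dg]
  have h2 : deriv (fun s => u s - c * v s) =ᶠ[𝓝 r] fun s => deriv u s - c * deriv v s := by
    filter_upwards [hU.mem_nhds hr] with s hs using h1 hu hv s hs
  rw [radialLaplacian, h2.deriv_eq, h2.eq_of_nhds,
    h1 (hu.deriv_smooth hU) (hv.deriv_smooth hU) r hr, radialLaplacian,
    radialLaplacian]
  ring

end Radial

end

theorem proposition1p1 (p q : ℕ) (U V : TopologicalSpace.Opens ℝ) (σ lam ρ : ℝ → ℝ) (k : ℝ)
    (hσ : ContDiffOn ℝ ∞ σ U) (hσ_pos : ∀ r ∈ U, 0 < σ r)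
    (hlam : ContDiffOn ℝ ∞ lam V) (hlam_pos : ∀ s ∈ V, 0 < lam s)
    (hρ : ContDiffOn ℝ ∞ ρ U) (hρV : ∀ r ∈ U, ρ r ∈ V)
    (φ : UnitSphere p → UnitSphere q) (hφ : IsEigenmap p q φ k) :
    (IsBiharmonicMap (warpedMetric p U σ) (warpedMetric q V lam) (equivariantMap ρ hρV φ) ↔
      ∃ F : ℝ → ℝ,
        (∀ r ∈ U, F r = deriv (deriv ρ) r + p * (deriv σ r / σ r) * deriv ρ r
          - 2 * k * (lam (ρ r) * deriv lam (ρ r) / σ r ^ 2)) ∧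
        (∀ r ∈ U, deriv (deriv F) r + p * (deriv σ r / σ r) * deriv F r
          - 2 * k * (deriv (fun s => lam s * deriv lam s) (ρ r) / σ r ^ 2) * F r = 0)) ∧
    (IsBiharmonicMap (warpedMetric p U σ) (warpedMetric q V lam) (equivariantMap ρ hρV φ) ↔
      ∀ x : U × UnitSphere p,
        laplaceBeltrami (warpedMetric p U σ)
            (laplaceBeltrami (warpedMetric p U σ) (fun y => ρ y.1)) x
          - 2 * k * laplaceBeltrami (warpedMetric p U σ)
              (fun y => lam (ρ y.1) * deriv lam (ρ y.1) / σ y.1 ^ 2) x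
          - 2 * k * (deriv (fun s => lam s * deriv lam s) (ρ x.1) / σ x.1 ^ 2)
            * (laplaceBeltrami (warpedMetric p U σ) (fun y => ρ y.1) x
                - 2 * k * (lam (ρ x.1) * deriv lam (ρ x.1) / σ x.1 ^ 2)) = 0) := by
  rw [isBiharmonicMap_equivariantMap_iff hσ hσ_pos hlam hlam_pos hρ hρV hφ]
  have hσ0 : ∀ r ∈ U, σ r ≠ 0 := fun r hr => (hσ_pos r hr).ne'
  constructor
  · constructor
    · exact fun h => ⟨radialTension p k σ lam ρ, fun r _ => rfl, h⟩
    · rintro ⟨F, hF, h⟩ r hr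
      have hFE : Set.EqOn (radialTension p k σ lam ρ) F U := fun s hs => (hF s hs).symm
      rw [radialBitension, radialLaplacian_congr p U.isOpen hFE hr, hFE hr]
      exact h r hr
  · have hL : ContDiffOn ℝ ∞ (radialLaplacian p σ ρ) U :=
      contDiffOn_radialLaplacian p U.isOpen hσ hσ0 hρ
    have hN : ContDiffOn ℝ ∞ (fun r => lam (ρ r) * deriv lam (ρ r) / σ r ^ 2) U :=
      ((hlam.mul (hlam.deriv_smooth V.isOpen)).comp hρ hρV).div (hσ.pow 2)
        fun r hr => pow_ne_zero 2 (hσ0 r hr)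
    have hΔ : laplaceBeltrami (warpedMetric p U σ) (fun y => ρ y.1)
        = fun y => radialLaplacian p σ ρ y.1 :=
      funext fun y => laplaceBeltrami_radial hσ hσ_pos hρ y
    have key : ∀ x : U × UnitSphere p,
        laplaceBeltrami (warpedMetric p U σ)
            (laplaceBeltrami (warpedMetric p U σ) (fun y => ρ y.1)) x
          - 2 * k * laplaceBeltrami (warpedMetric p U σ)
              (fun y => lam (ρ y.1) * deriv lam (ρ y.1) / σ y.1 ^ 2) x
          - 2 * k * (deriv (fun s => lam s * deriv lam s) (ρ x.1) / σ x.1 ^ 2)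
            * (laplaceBeltrami (warpedMetric p U σ) (fun y => ρ y.1) x
                - 2 * k * (lam (ρ x.1) * deriv lam (ρ x.1) / σ x.1 ^ 2))
        = radialBitension p k σ lam ρ (radialTension p k σ lam ρ) x.1 := fun x => by
      rw [hΔ, laplaceBeltrami_radial hσ hσ_pos hL,
        laplaceBeltrami_radial (u := fun r => lam (ρ r) * deriv lam (ρ r) / σ r ^ 2) hσ hσ_pos hN,
        ← radialLaplacian_sub_const_mul p U.isOpen hL hN (2 * k) x.1.2]
      rfl
    simp only [key]
    obtain ⟨θ⟩ := nonempty_unitSphere p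
    exact ⟨fun h x => h x.1 x.1.2, fun h r hr => h (⟨r, hr⟩, θ)⟩
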